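/- Let $R_\infty$ be the semigroup of all partial bijections $r$ of $\mathbb N$ (bijections between subsets of $\mathbb N$) for which the complement of $\{x : r(x)=x\}$ is finite, with composition as product and the inverse partial bijection $r^\star$ as involution. Let $\mathfrak S_\infty\subset R_\infty$ be the group of permutations of $\mathbb N$ that move only finitely many points and, for a finite set $\mathbb A\subset\mathbb N$, let $\epsilon_{\mathbb A}\in R_\infty$ be the identity map of $\mathbb N\setminus\mathbb A$. A state on $R_\infty$ is a function $\varphi:R_\infty\to\mathbb C$ with $\varphi(e)=1$, where $e$ is the identity of $R_\infty$, such that the matrix $[\varphi(r_j^\star r_i)]_{i,j}$ is positive semidefinite for every finite family $(r_i)$ in $R_\infty$; it is $\mathfrak S_\infty$-central if $\varphi(sr)=\varphi(rs)$ for all $s\in\mathfrak S_\infty$, $r\in R_\infty$. Let $(\pi_\varphi,\mathcal H_\varphi,\xi_\varphi)$ be the GNS representation of $\varphi$: a $*$-representation of $R_\infty$ by bounded operators on a Hilbert space $\mathcal H_\varphi$ with $\pi_\varphi(e)=I$ and with a cyclic vector $\xi_\varphi$ such that $\varphi(r)=(\pi_\varphi(r)\xi_\varphi,\xi_\varphi)$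 for all $r\in R_\infty$. Let $\varphi$ be an $\mathfrak S_\infty$-central state on $R_\infty$ such that the von Neumann algebra $\pi_\varphi(R_\infty)''$ is a factor of type $\mathrm I$ (finite or infinite). Then at least one of the following holds: 1) $\varphi$ is two-sided $\mathfrak S_\infty$-invariant, i.e. $\varphi(srt)=\varphi(r)$ for all $s,t\in\mathfrak S_\infty$ and $r\in R_\infty$; 2) for all $s\in\mathfrak S_\infty$ and all finite $\mathbb A\subset\mathbb N$, $$\varphi(s\,\epsilon_{\mathbb A})=\begin{cases}\operatorname{sign}(s),&\mathbb A=\emptyset,\\ 0,&\mathbb A\neq\emptyset,\end{cases}$$ where $\operatorname{sign}(s)$ is $1$ if $s$ is a product of an even number of transpositions and $-1$ otherwise. -/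

import Mathlib

/-- The infinite symmetric inverse semigroup: the partial bijections `r` of `ℕ` such that the
complement of `{x | r x = x}` is finite. -/
def RInf : Type :=
  {r : ℕ ≃. ℕ // {x | r x ≠ some x}.Finite}

namespace RInf

theorem ext {r q : RInf} (h : ∀ x, r.1 x = q.1 x) : r = q :=
  Subtype.ext (PEquiv.ext h)

/-- The product is the composition `(r * q) x = r (q x)`, that is, the product of 0-1 matrices
(with `r_{lk} = 1` iff `r k = l`). -/
instance : Mul RInf where
  mul r q := ⟨q.1.trans r.1, by
    refine (r.2.union q.2).subset fun x hx => ?_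
    by_contra h
    simp only [Set.mem_union, Set.mem_ofPred_eq, not_or, not_not] at h
    exact hx ((PEquiv.trans_eq_some _ _ _ _).2 ⟨x, h.2, h.1⟩)⟩

instance : One RInf where
  one := ⟨PEquiv.refl ℕ, by simp⟩

instance : Monoid RInf where
  mul_assoc a b c := Subtype.ext (PEquiv.trans_assoc c.1 b.1 a.1).symm
  one_mul a := Subtype.ext (PEquiv.trans_refl a.1)
  mul_one a := Subtype.ext (PEquiv.refl_trans a.1)

/-- The involution is the inverse partial bijection, that is, the transposed matrix. -/
instance : StarMul RInf where
  star r := ⟨r.1.symm, r.2.subset fun _ hx h => hx ((PEquiv.eq_some_iff _).2 h)⟩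
  star_involutive _ := rfl
  star_mul r q := Subtype.ext (PEquiv.symm_trans_rev q.1 r.1)

/-- The idempotent `ε_A`: the identity partial bijection with domain `ℕ \ A`, `A` finite. -/
def eps (A : Finset ℕ) : RInf :=
  ⟨PEquiv.ofSet {x | x ∉ A}, A.finite_toSet.subset fun x hx => by
    by_contra h
    exact hx (PEquiv.ofSet_eq_some_self_iff.2 h)⟩

end RInf

/-- The infinite symmetric group: the permutations of `ℕ` that move only finitely many points. -/
def SInf : Subgroup (Equiv.Perm ℕ) where
  carrier := {s | {i | s i ≠ i}.Finite}
  one_mem' := by simp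
  mul_mem' {s t} hs ht := by
    refine (hs.union ht).subset fun x hx => ?_
    by_contra h
    simp only [Set.mem_union, Set.mem_ofPred_eq, not_or, not_not] at h
    exact hx (by rw [Equiv.Perm.mul_apply, h.2, h.1])
  inv_mem' {s} hs := hs.subset fun x hx h => hx (Equiv.Perm.inv_eq_iff_eq.2 h.symm)

/-- The inclusion of the infinite symmetric group in the symmetric inverse semigroup. -/
def SInf.toRInf : SInf →* RInf where
  toFun s := ⟨s.1.toPEquiv, s.2.subset fun x hx h => hx (by simp [h])⟩
  map_one' := Subtype.ext Equiv.toPEquiv_refl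
  map_mul' s t := Subtype.ext (Equiv.toPEquiv_trans t.1 s.1).symm

open Classical in
/-- The sign of a finite permutation: `1` if it is a product of an even number of transpositions
and `-1` otherwise. -/
noncomputable def SInf.sign (s : SInf) : ℤ :=
  if ∃ l : List (Equiv.Perm ℕ), (∀ g ∈ l, g.IsSwap) ∧ l.prod = s.1 ∧ Even l.length then 1 else -1

namespace RInf

open scoped ComplexOrder in
/-- Positive definite functions with value `1` at the unit. -/
structure IsState (φ : RInf → ℂ) : Prop where
  posDef : ∀ (n : ℕ) (r : Fin n → RInf),
    (Matrix.of fun i j => φ (star (r j) * r i)).PosSemidef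
  map_one : φ 1 = 1

/-- `φ` is central with respect to the infinite symmetric group. -/
def IsSInfCentral (φ : RInf → ℂ) : Prop :=
  ∀ (s : SInf) (r : RInf), φ (SInf.toRInf s * r) = φ (r * SInf.toRInf s)

/-- `φ` is two-sided invariant under the infinite symmetric group. -/
def IsTwoSidedInvariant (φ : RInf → ℂ) : Prop :=
  ∀ (s t : SInf) (r : RInf), φ (SInf.toRInf s * r * SInf.toRInf t) = φ r

variable {H : Type*} [NormedAddCommGroup H] [InnerProductSpace ℂ H] [CompleteSpace H]

/-- `(π, H, ξ)` is the GNS representation of `φ` (which is unique up to unitary equivalence): a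
unital `*`-representation with cyclic vector `ξ` such that `φ r = (π r ξ, ξ)`. Mathlib's inner
product is linear in the second argument. -/
structure IsGNS (φ : RInf → ℂ) (π : RInf →⋆* (H →L[ℂ] H)) (ξ : H) : Prop where
  cyclic : (Submodule.span ℂ (Set.range fun r => π r ξ)).topologicalClosure = ⊤
  apply_eq : ∀ r, φ r = inner ℂ ξ (π r ξ)

theorem union_star_range (π : RInf →⋆* (H →L[ℂ] H)) :
    Set.range π ∪ star (Set.range π) = Set.range π := by
  refine Set.union_eq_left.2 ?_
  rintro x ⟨r, hr⟩
  exact ⟨star r, by rw [map_star, hr, star_star]⟩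

/-- The von Neumann algebra `π(R_∞)''`. -/
noncomputable def vonNeumann (π : RInf →⋆* (H →L[ℂ] H)) : VonNeumannAlgebra H where
  toStarSubalgebra :=
    StarSubalgebra.centralizer ℂ (StarSubalgebra.centralizer ℂ (Set.range π) : Set (H →L[ℂ] H))
  centralizer_centralizer' := by
    change Set.centralizer (Set.centralizer ((StarSubalgebra.centralizer ℂ
      (StarSubalgebra.centralizer ℂ (Set.range π) : Set (H →L[ℂ] H)) : Set (H →L[ℂ] H)))) = _
    rw [StarSubalgebra.coe_centralizer_centralizer, Set.centralizer_centralizer_centralizer]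
    exact (StarSubalgebra.coe_centralizer_centralizer (R := ℂ) (Set.range π)).symm

theorem coe_vonNeumann (π : RInf →⋆* (H →L[ℂ] H)) :
    (vonNeumann π : Set (H →L[ℂ] H)) = (Set.range π).centralizer.centralizer := by
  rw [← union_star_range π]
  exact StarSubalgebra.coe_centralizer_centralizer (R := ℂ) (Set.range π)

end RInf

namespace VonNeumannAlgebra

variable {H : Type*} [NormedAddCommGroup H] [InnerProductSpace ℂ H] [CompleteSpace H]

/-- A factor: the only operators in both `M` and its commutant are the scalars. -/
def IsFactor (M : VonNeumannAlgebra H) : Prop :=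
  ∀ z ∈ M, z ∈ M.commutant → ∃ c : ℂ, z = c • (1 : H →L[ℂ] H)

/-- `M` is of type I: it contains an abelian projection `e` (`eMe` is commutative) whose central
support is the identity. -/
def IsTypeI (M : VonNeumannAlgebra H) : Prop :=
  ∃ e ∈ M, IsStarProjection e ∧
    (∀ a ∈ M, ∀ b ∈ M, Commute (e * a * e) (e * b * e)) ∧
    ∀ z ∈ M, z ∈ M.commutant → IsStarProjection z → z * e = e → z = 1

end VonNeumannAlgebra

open Filter Topology

namespace VonNeumannAlgebra

variable {H : Type*} [NormedAddCommGroup H] [InnerProductSpace ℂ H] [CompleteSpace H]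

theorem mem_of_forall_commutant {M : VonNeumannAlgebra H} {x : H →L[ℂ] H}
    (h : ∀ y ∈ M.commutant, y * x = x * y) : x ∈ M := by
  rw [← M.commutant_commutant]
  exact mem_commutant_iff.2 h

theorem smul_mem (M : VonNeumannAlgebra H) (c : ℂ) {x : H →L[ℂ] H} (hx : x ∈ M) : c • x ∈ M :=
  M.toStarSubalgebra.smul_mem hx c

theorem cfcₙ_mem {M : VonNeumannAlgebra H} {a : H →L[ℂ] H} (ha : a ∈ M)
    (f : ℝ → ℝ) : cfcₙ f a ∈ M := by
  refine mem_of_forall_commutant fun y hy => ?_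
  have h : Commute a y := mem_commutant_iff.1 hy a ha
  exact (h.cfcₙ_real f).symm

/-- In a factor, `p M q = 0` forces `p = 0` or `q = 0`. -/
theorem IsFactor.eq_zero_or_eq_zero {M : VonNeumannAlgebra H} (hM : M.IsFactor)
    {p q : H →L[ℂ] H} (hp : p ∈ M) (h : ∀ m ∈ M, p * m * q = 0) : p = 0 ∨ q = 0 := by
  let N : Submodule ℂ H := ⨅ m : M, (p * (m : H →L[ℂ] H)).ker
  have hmem (v : H) : v ∈ N ↔ ∀ m ∈ M, p (m v) = 0 := by
    simp [N, Submodule.mem_iInf]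
  have hclosed : IsClosed (N : Set H) := by
    simp only [N, Submodule.coe_iInf]
    exact isClosed_iInter fun m => (p * (m : H →L[ℂ] H)).isClosed_ker
  have : CompleteSpace N := hclosed.completeSpace_coe
  have hz : IsStarProjection N.starProjection := isStarProjection_starProjection
  have hzM : N.starProjection ∈ M := by
    rw [IsStarProjection.mem_iff hz]
    intro y hy v hv
    rw [Submodule.range_starProjection] at hv
    simp only [Submodule.mem_comap, Submodule.range_starProjection, hmem] at hv ⊢
    intro m hm
    have := congr($(mem_commutant_iff.1 hy (p * m) (mul_mem hp hm)) v)
    simp only [mul_apply_eq_comp, ContinuousLinearMap.coe_coe] at this ⊢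
    rw [this, hv m hm, map_zero]
  have hzM' : N.starProjection ∈ M.commutant := by
    rw [IsStarProjection.mem_iff hz]
    intro y hy v hv
    rw [commutant_commutant] at hy
    rw [Submodule.range_starProjection] at hv
    simp only [Submodule.mem_comap, Submodule.range_starProjection, hmem] at hv ⊢
    exact fun m hm => hv (m * y) (mul_mem hm hy)
  obtain ⟨c, hc⟩ := hM _ hzM hzM'
  by_cases hq : q = 0
  · exact .inr hq
  left
  obtain ⟨v, hv⟩ := DFunLike.ne_iff.1 hq
  have hqv : q v ∈ N := (hmem _).2 fun m hm => congr($(h m hm) v)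
  have h1 : N.starProjection (q v) = q v := Submodule.starProjection_eq_self_iff.2 hqv
  have hc1 : c = 1 := by
    rw [hc] at h1
    have h2 : (c - 1) • q v = 0 := by
      rw [sub_smul, one_smul, sub_eq_zero]; exact h1
    exact sub_eq_zero.1 ((smul_eq_zero.1 h2).resolve_right hv)
  ext w
  have hw : w ∈ N := Submodule.starProjection_eq_self_iff.1 (by rw [hc, hc1]; simp)
  exact (hmem w).1 hw 1 (one_mem M)

/-- For a selfadjoint operator `b = b e` in a factor, with `e` an abelian projection, one of the
positive and the negative part vanishes on the range of `e`. -/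
theorem IsFactor.posPart_mul_eq_zero_or {M : VonNeumannAlgebra H} (hM : M.IsFactor)
    {e b : H →L[ℂ] H} (he : e ∈ M) (hee : IsIdempotentElem e)
    (hcomm : ∀ a ∈ M, ∀ b ∈ M, Commute (e * a * e) (e * b * e))
    (hb : b ∈ M) (heb : Commute e b) : b⁺ * e = 0 ∨ b⁻ * e = 0 := by
  have hp : b⁺ ∈ M := cfcₙ_mem hb _
  have hq : b⁻ ∈ M := cfcₙ_mem hb _
  have hpe : b⁺ * e = e * b⁺ := heb.symm.cfcₙ_real _
  have hqe : b⁻ * e = e * b⁻ := heb.symm.cfcₙ_real _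
  refine hM.eq_zero_or_eq_zero (mul_mem hp he) fun m hm => ?_
  have h := (hcomm _ hp m hm).eq
  have h1 : e * b⁺ * e = b⁺ * e := by rw [← hpe, mul_assoc, hee.eq]
  calc b⁺ * e * m * (b⁻ * e) = (e * b⁺ * e) * (e * m * e) * b⁻ := by
        rw [h1, hqe]; simp only [mul_assoc]; rw [← mul_assoc e e, hee.eq]
    _ = e * m * e * (e * (b⁺ * b⁻)) := by
        rw [h, h1, hpe]; simp only [mul_assoc]
    _ = 0 := by simp

theorem inner_apply_eq_zero_of_nonneg {q : H →L[ℂ] H} (hq : 0 ≤ q) {g : H}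
    (h : inner ℂ g (q g) = 0) : q g = 0 := by
  obtain ⟨s, rfl⟩ := CStarAlgebra.nonneg_iff_eq_star_mul_self.1 hq
  have : s g = 0 := by
    rw [← inner_self_eq_zero (𝕜 := ℂ), ← ContinuousLinearMap.adjoint_inner_right]
    exact h
  simp [this]

/-- Vectors in the range of an abelian projection `e` of a factor `M` are eigenvectors of the
selfadjoint elements of `e M e`. -/
theorem IsFactor.exists_apply_eq_smul {M : VonNeumannAlgebra H} (hM : M.IsFactor)
    {e a : H →L[ℂ] H} (he : e ∈ M) (hproj : IsStarProjection e)
    (hcomm : ∀ a ∈ M, ∀ b ∈ M, Commute (e * a * e) (e * b * e))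
    (ha : a ∈ M) (hsa : IsSelfAdjoint a) {g : H} (hg : e g = g) : ∃ c : ℂ, e (a g) = c • g := by
  have hee := hproj.isIdempotentElem
  have hes := hproj.isSelfAdjoint
  rcases eq_or_ne g 0 with rfl | hg0
  · exact ⟨0, by simp⟩
  let a' := e * a * e
  have ha's : IsSelfAdjoint a' := by
    have := hsa.conjugate e
    rwa [hes.star_eq] at this
  have hinner : ((inner ℂ g (a' g)).re : ℂ) = inner ℂ g (a' g) := by
    rw [← Complex.conj_eq_iff_re, inner_conj_symm, ← ContinuousLinearMap.adjoint_inner_right,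
      ← ContinuousLinearMap.star_eq_adjoint, ha's.star_eq]
  let t : ℝ := (inner ℂ g (a' g)).re / ‖g‖ ^ 2
  let b := a' - (t : ℂ) • e
  have hbM : b ∈ M := sub_mem (mul_mem (mul_mem he ha) he) (M.smul_mem _ he)
  have hbs : IsSelfAdjoint b := ha's.sub (by
    rw [IsSelfAdjoint, star_smul, hes.star_eq]; simp)
  have heb : e * b = b := by
    simp only [b, a', mul_sub, mul_smul_comm, hee.eq, ← mul_assoc]
  have hbe : b * e = b := by
    simp only [b, a', sub_mul, smul_mul_assoc, hee.eq, mul_assoc]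
  have hbg : b g = b⁺ g - b⁻ g := by
    conv_lhs => rw [← CFC.posPart_sub_negPart b hbs]
    rfl
  have hgb : inner ℂ g (b g) = 0 := by
    have hn : (‖g‖ : ℂ) ^ 2 ≠ 0 := by simpa using hg0
    simp only [b, sub_apply, smul_apply, hg, inner_sub_right,
      inner_smul_right, inner_self_eq_norm_sq_to_K, t, Complex.ofReal_div, Complex.ofReal_pow, hinner]
    simp [div_mul_cancel₀ _ hn]
  have key : b g = 0 := by
    rcases hM.posPart_mul_eq_zero_or he hee hcomm hbM (heb.trans hbe.symm) with h | h
    · have h0 : b⁺ g = 0 := by rw [← hg]; exact congr($h g)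
      rw [h0, zero_sub] at hbg
      rw [hbg] at hgb ⊢
      rw [inner_apply_eq_zero_of_nonneg (CFC.negPart_nonneg b) (by simpa using hgb), neg_zero]
    · have h0 : b⁻ g = 0 := by rw [← hg]; exact congr($h g)
      rw [h0, sub_zero] at hbg
      rw [hbg] at hgb ⊢
      exact inner_apply_eq_zero_of_nonneg (CFC.posPart_nonneg b) hgb
  refine ⟨t, ?_⟩
  have : a' g - (t : ℂ) • e g = 0 := key
  rw [hg, sub_eq_zero] at this
  rw [← this]
  simp [a', hg]

/-- An abelian projection `e` of a factor `M` is minimal: orthogonal vectors in the range of `e`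
generate orthogonal `M`-invariant subspaces. -/
theorem IsFactor.inner_apply_eq_zero {M : VonNeumannAlgebra H} (hM : M.IsFactor)
    {e : H →L[ℂ] H} (he : e ∈ M) (hproj : IsStarProjection e)
    (hcomm : ∀ a ∈ M, ∀ b ∈ M, Commute (e * a * e) (e * b * e))
    {f g : H} (hf : e f = f) (hg : e g = g) (hfg : inner ℂ f g = 0)
    {a : H →L[ℂ] H} (ha : a ∈ M) : inner ℂ f (a g) = 0 := by
  have hsa (a : H →L[ℂ] H) (ha : a ∈ M) (hsa : IsSelfAdjoint a) : inner ℂ f (a g) = 0 := by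
    obtain ⟨c, hc⟩ := hM.exists_apply_eq_smul he hproj hcomm ha hsa hg
    rw [← hf, ← ContinuousLinearMap.adjoint_inner_right, ← ContinuousLinearMap.star_eq_adjoint,
      hproj.isSelfAdjoint.star_eq, hc, inner_smul_right, hfg, mul_zero]
  have hre : (realPart a : H →L[ℂ] H) ∈ M := by
    rw [realPart_apply_coe, ← Complex.coe_smul]
    exact M.smul_mem _ (add_mem ha (star_mem ha))
  have him : (imaginaryPart a : H →L[ℂ] H) ∈ M := by
    rw [imaginaryPart_apply_coe, ← Complex.coe_smul (_ : ℝ) (a - star a)]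
    exact M.smul_mem _ (M.smul_mem _ (sub_mem ha (star_mem ha)))
  rw [← realPart_add_I_smul_imaginaryPart a]
  simp only [add_apply, smul_apply, inner_add_right,
    inner_smul_right, hsa _ hre (realPart a).2, hsa _ him (imaginaryPart a).2]
  simp

end VonNeumannAlgebra

section Hilbert

variable {H : Type*} [NormedAddCommGroup H] [InnerProductSpace ℂ H]

/-- Bessel's inequality for the components of `ξ` along pairwise orthogonal subspaces. -/
theorem sum_norm_sq_le_of_pairwise_orthogonal {ι : Type*} {ξ : H} {w : ι → H}
    (hw : Pairwise fun i j => inner ℂ (w i) (w j) = 0)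
    (h : ∀ i, inner ℂ (w i) ξ = inner ℂ (w i) (w i)) (s : Finset ι) :
    ∑ i ∈ s, ‖w i‖ ^ 2 ≤ ‖ξ‖ ^ 2 := by
  classical
  have h1 : inner ℂ (∑ i ∈ s, w i) (ξ - ∑ i ∈ s, w i) = 0 := by
    rw [inner_sub_right, sum_inner, sum_inner, ← Finset.sum_sub_distrib]
    refine Finset.sum_eq_zero fun i hi => ?_
    rw [h, inner_sum, Finset.sum_eq_single_of_mem i hi fun j _ hj => hw hj.symm, sub_self]
  have h2 : ‖∑ i ∈ s, w i‖ ^ 2 = ∑ i ∈ s, ‖w i‖ ^ 2 := by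
    have : (inner ℂ (∑ i ∈ s, w i) (∑ i ∈ s, w i)) = ∑ i ∈ s, inner ℂ (w i) (w i) := by
      rw [sum_inner]
      refine Finset.sum_congr rfl fun i hi => ?_
      rw [inner_sum, Finset.sum_eq_single_of_mem i hi fun j _ hj => hw hj.symm]
    simp only [inner_self_eq_norm_sq_to_K] at this
    exact_mod_cast this
  have h3 := norm_add_sq_eq_norm_sq_add_norm_sq_of_inner_eq_zero _ _ h1
  rw [add_sub_cancel] at h3
  nlinarith [norm_nonneg (ξ - ∑ i ∈ s, w i)]

/-- Bounded families of operators converge weakly along ultrafilters. -/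
theorem Ultrafilter.exists_tendsto_inner [CompleteSpace H] {ι : Type*} (F : Ultrafilter ι)
    (u : ι → H →L[ℂ] H) {C : ℝ} (hu : ∀ i, ‖u i‖ ≤ C) :
    ∃ O : H →L[ℂ] H, ∀ v w,
      Tendsto (fun i => inner ℂ v (u i w)) F (𝓝 (inner ℂ v (O w))) := by
  have hbound (v w : H) (i : ι) : ‖inner ℂ (u i v) w‖ ≤ C * ‖v‖ * ‖w‖ :=
    (norm_inner_le_norm _ _).trans (by gcongr; exact (u i).le_of_opNorm_le (hu i) v)
  have hex (v w : H) : ∃ c, Tendsto (fun i => inner ℂ (u i v) w) F (𝓝 c) := by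
    obtain ⟨c, -, hc⟩ := (isCompact_closedBall (0 : ℂ) (C * ‖v‖ * ‖w‖)).ultrafilter_le_nhds
      (F.map fun i => inner ℂ (u i v) w) (by
        rw [Ultrafilter.coe_map, le_principal_iff, Filter.mem_map]
        exact Filter.univ_mem' fun i => by simpa using hbound v w i)
    exact ⟨c, hc⟩
  choose L hL using hex
  let B : H →L⋆[ℂ] H →L[ℂ] ℂ := LinearMap.mkContinuous₂
    (LinearMap.mk₂'ₛₗ (starRingEnd ℂ) (RingHom.id ℂ) L
      (fun v v' w => tendsto_nhds_unique (hL (v + v') w) (by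
        simpa only [map_add, inner_add_left] using (hL v w).add (hL v' w)))
      (fun c v w => tendsto_nhds_unique (hL (c • v) w) (by
        simpa only [map_smul, inner_smul_left, smul_eq_mul] using (hL v w).const_mul _))
      (fun v w w' => tendsto_nhds_unique (hL v (w + w')) (by
        simpa only [inner_add_right] using (hL v w).add (hL v w')))
      (fun c v w => tendsto_nhds_unique (hL v (c • w)) (by
        simpa only [inner_smul_right, smul_eq_mul, RingHom.id_apply] using
          (hL v w).const_mul c))) C
    (fun v w => le_of_tendsto (hL v w).norm (Eventually.of_forall (hbound v w)))
  refine ⟨InnerProductSpace.continuousLinearMapOfBilin B, fun v w => ?_⟩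
  have h : inner ℂ (InnerProductSpace.continuousLinearMapOfBilin B w) v = L w v :=
    InnerProductSpace.continuousLinearMapOfBilin_apply B w v
  have h2 := (Complex.continuous_conj.tendsto _).comp (hL w v)
  rw [← h, inner_conj_symm] at h2
  exact h2.congr fun i => inner_conj_symm _ _

end Hilbert

namespace VonNeumannAlgebra

variable {H : Type*} [NormedAddCommGroup H] [InnerProductSpace ℂ H] [CompleteSpace H]

/-- The closure of `M f`. -/
noncomputable def cyclicSubspace (M : VonNeumannAlgebra H) (f : H) : Submodule ℂ H :=
  (M.toStarSubalgebra.toSubalgebra.toSubmodule.map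
    (ContinuousLinearMap.apply ℂ H f).toLinearMap).topologicalClosure

theorem apply_mem_cyclicSubspace {M : VonNeumannAlgebra H} {m : H →L[ℂ] H} (hm : m ∈ M) (f : H) :
    m f ∈ M.cyclicSubspace f :=
  Submodule.le_topologicalClosure _ ⟨m, hm, rfl⟩

instance (M : VonNeumannAlgebra H) (f : H) : CompleteSpace (M.cyclicSubspace f) :=
  (Submodule.isClosed_topologicalClosure _).completeSpace_coe

theorem isOrtho_cyclicSubspace {M : VonNeumannAlgebra H} {f g : H}
    (h : ∀ a ∈ M, inner ℂ f (a g) = 0) : M.cyclicSubspace f ⟂ M.cyclicSubspace g := by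
  rw [Submodule.isOrtho_iff_le, cyclicSubspace, cyclicSubspace, Submodule.orthogonal_closure]
  refine Submodule.topologicalClosure_minimal _ ?_ (Submodule.isClosed_orthogonal _)
  rintro _ ⟨m, hm, rfl⟩
  rw [Submodule.mem_orthogonal']
  rintro _ ⟨n, hn, rfl⟩
  have := h (star m * n) (mul_mem (star_mem hm) hn)
  rwa [mul_apply_eq_comp, ContinuousLinearMap.star_eq_adjoint,
    ContinuousLinearMap.adjoint_inner_right] at this

/-- Suppose that contractions `u i` in a factor `M` with an abelian projection `e` converge weakly
to `l • 1`, and that each `u i ξ` is also the image of `ξ` under an isometry in the commutant.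
Then `l` has modulus one. -/
theorem IsFactor.norm_eq_one_of_tendsto {M : VonNeumannAlgebra H} (hM : M.IsFactor)
    {e : H →L[ℂ] H} (he : e ∈ M) (hproj : IsStarProjection e)
    (hcomm : ∀ a ∈ M, ∀ b ∈ M, Commute (e * a * e) (e * b * e))
    {ι : Type*} {F : Filter ι} [F.NeBot] {u U : ι → H →L[ℂ] H} {l : ℂ} {ξ : H}
    (huM : ∀ i, u i ∈ M) (hu : ∀ i, ‖u i‖ ≤ 1)
    (hUM : ∀ i, U i ∈ M.commutant) (hU : ∀ i v, ‖U i v‖ = ‖v‖) (hUu : ∀ i, U i ξ = u i ξ)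
    (hlim : ∀ v w, Tendsto (fun i => inner ℂ v (u i w)) F (𝓝 (l * inner ℂ v w)))
    {x : H →L[ℂ] H} (hx : x ∈ M) (hx0 : e (x ξ) ≠ 0) : ‖l‖ = 1 := by
  have hee (v : H) : e (e v) = e v := congr($(hproj.isIdempotentElem.eq) v)
  have hes (v w : H) : inner ℂ (e v) w = inner ℂ v (e w) := by
    rw [← ContinuousLinearMap.adjoint_inner_right, ← ContinuousLinearMap.star_eq_adjoint,
      hproj.isSelfAdjoint.star_eq]
  let E : Submodule ℂ H := (1 - e).ker
  have hE (v : H) : v ∈ E ↔ e v = v := by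
    rw [eq_comm, ← sub_eq_zero]
    rfl
  have : CompleteSpace E := (1 - e).isClosed_ker.completeSpace_coe
  obtain ⟨w, b, -⟩ := exists_hilbertBasis ℂ E
  have hb (a : w) : e (b a) = b a := (hE _).1 (b a).2
  let P (a : w) : H := (M.cyclicSubspace (b a)).starProjection ξ
  have hP (a : w) {v : H} (hv : v ∈ M.cyclicSubspace (b a)) :
      inner ℂ v ξ = inner ℂ v (P a) := by
    conv_lhs => rw [← Submodule.starProjection_eq_self_iff.2 hv]
    exact Submodule.inner_starProjection_left_eq_right _ _ _
  have hPmem (a : w) : P a ∈ M.cyclicSubspace (b a) := Submodule.starProjection_apply_mem _ _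
  have hsum : Summable fun a => ‖P a‖ ^ 2 := by
    refine summable_of_sum_le (fun a => by positivity) (c := ‖ξ‖ ^ 2) ?_
    refine sum_norm_sq_le_of_pairwise_orthogonal (fun a a' haa' => ?_) fun a => hP a (hPmem a)
    refine Submodule.isOrtho_iff_inner_eq.1 (isOrtho_cyclicSubspace fun m hm => ?_) _ (hPmem a)
      _ (hPmem a')
    exact hM.inner_apply_eq_zero he hproj hcomm (hb a) (hb a') (b.orthonormal.2 haa') hm
  let y (i : ι) : E := ⟨e (x (u i ξ)), (hE _).2 (hee _)⟩
  let y₀ : E := ⟨e (x ξ), (hE _).2 (hee _)⟩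
  have hy (i : ι) : ‖y i‖ = ‖y₀‖ := by
    have h := congr($(mem_commutant_iff.1 (hUM i) (e * x) (mul_mem he hx)) ξ)
    simp only [mul_apply_eq_comp, hUu] at h
    change ‖e (x (u i ξ))‖ = ‖e (x ξ)‖
    rw [h, hU]
  have hinner (a : w) (v : H) :
      inner ℂ ((b a : E) : H) (e (x v)) = inner ℂ (star x (b a)) v := by
    rw [← hes, hb, ContinuousLinearMap.star_eq_adjoint, ContinuousLinearMap.adjoint_inner_left]
  have hterm (a : w) :
      Tendsto (fun i => inner ℂ (b a) (y i)) F (𝓝 (l * inner ℂ (b a) y₀)) := by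
    have := hlim (star x (b a)) ξ
    simp only [← hinner] at this
    exact this
  have hterm_le (i : ι) (a : w) : ‖inner ℂ (b a) (y i)‖ ≤ ‖star x‖ * ‖P a‖ := by
    change ‖inner ℂ ((b a : E) : H) (e (x (u i ξ)))‖ ≤ _
    rw [hinner, ← ContinuousLinearMap.adjoint_inner_left, ← ContinuousLinearMap.star_eq_adjoint,
      hP a (v := star (u i) (star x (b a)))
        (apply_mem_cyclicSubspace (mul_mem (star_mem (huM i)) (star_mem hx)) (b a : H))]
    refine (norm_inner_le_norm _ _).trans ?_
    gcongr
    have hba : ‖((b a : E) : H)‖ = 1 := b.orthonormal.1 a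
    calc ‖star (u i) (star x (b a))‖ ≤ 1 * ‖star x (b a)‖ :=
          (star (u i)).le_of_opNorm_le ((norm_star _).trans_le (hu i)) _
      _ ≤ 1 * (‖star x‖ * ‖((b a : E) : H)‖) := by gcongr; exact (star x).le_opNorm _
      _ = ‖star x‖ := by rw [hba]; ring
  have htend := tendsto_tsum_of_dominated_convergence (𝓕 := F)
    (f := fun i a => inner ℂ (y i) (b a) * inner ℂ (b a) (y i))
    (g := fun a => starRingEnd ℂ l * l * (inner ℂ y₀ (b a) * inner ℂ (b a) y₀))
    (hsum.mul_left (‖star x‖ ^ 2)) (fun a => by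
      have h := ((Complex.continuous_conj.tendsto _).comp (hterm a)).mul (hterm a)
      rw [map_mul, inner_conj_symm] at h
      refine (h.congr fun i => ?_).trans_eq (by ring_nf)
      simp [inner_conj_symm])
    (Eventually.of_forall fun i a => by
      rw [norm_mul, norm_inner_symm, ← mul_pow, pow_two]
      have := hterm_le i a
      gcongr)
  rw [tsum_mul_left] at htend
  simp only [b.tsum_inner_mul_inner, inner_self_eq_norm_sq_to_K, hy] at htend
  have heq := tendsto_nhds_unique htend tendsto_const_nhds
  have hn : ((‖y₀‖ : ℂ)) ^ 2 ≠ 0 := by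
    have : y₀ ≠ 0 := fun h => hx0 congr(($h : H))
    simpa using this
  have h1 : starRingEnd ℂ l * l = 1 := mul_right_cancel₀ hn (heq.trans (one_mul _).symm)
  rw [Complex.conj_mul'] at h1
  have h2 : ‖l‖ ^ 2 = 1 := by exact_mod_cast h1
  exact (pow_eq_one_iff_of_nonneg (norm_nonneg l) two_ne_zero).1 h2

end VonNeumannAlgebra

/-- The transposition of two natural numbers as an element of the infinite symmetric group. -/
def SInf.swap (a b : ℕ) : SInf :=
  ⟨Equiv.swap a b, (Set.toFinite {a, b}).subset fun x hx => by
    by_contra h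
    simp only [Set.mem_insert_iff, Set.mem_singleton_iff, not_or] at h
    exact hx (Equiv.swap_apply_of_ne_of_ne h.1 h.2)⟩

theorem SInf.swap_mul_self (a b : ℕ) : SInf.swap a b * SInf.swap a b = 1 :=
  Subtype.ext (Equiv.swap_mul_self a b)

/-- Every finite permutation is a product of transpositions. -/
theorem SInf.exists_swap_list (s : SInf) :
    ∃ l : List (Equiv.Perm ℕ), (∀ g ∈ l, g.IsSwap) ∧ l.prod = s.1 := by
  have h : s.1 ∈ Subgroup.closure {σ : Equiv.Perm ℕ | σ.IsSwap} :=
    mem_closure_isSwap'.2 s.2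
  rw [← Subgroup.mem_toSubmonoid, Subgroup.closure_toSubmonoid] at h
  obtain ⟨l, hl, hprod⟩ := Submonoid.exists_list_of_mem_closure h
  refine ⟨l, fun g hg => ?_, hprod⟩
  rcases hl g hg with h | ⟨x, y, hxy, h⟩
  · exact h
  · exact ⟨x, y, hxy, by rw [← inv_inv g, h, Equiv.swap_inv]⟩

/-- Any two transpositions are conjugate in the infinite symmetric group. -/
theorem SInf.exists_conj_swap {a b c d : ℕ} (hab : a ≠ b) (hcd : c ≠ d) :
    ∃ s : SInf, s * SInf.swap a b * s⁻¹ = SInf.swap c d := by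
  refine ⟨SInf.swap (Equiv.swap a c b) d * SInf.swap a c, Subtype.ext ?_⟩
  have h := Equiv.swap_apply_apply (Equiv.swap (Equiv.swap a c b) d * Equiv.swap a c) a b
  have hb : c ≠ Equiv.swap a c b := by
    rw [← Equiv.swap_apply_left a c]
    exact fun h => hab ((Equiv.swap a c).injective (by simpa using h))
  simp only [Equiv.Perm.mul_apply, Equiv.swap_apply_left,
    Equiv.swap_apply_of_ne_of_ne hb hcd] at h
  exact h.symm

namespace RInf

theorem mul_apply (r q : RInf) (x : ℕ) : (r * q).1 x = (q.1 x).bind r.1 := rfl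

theorem toRInf_apply (s : SInf) (x : ℕ) : (SInf.toRInf s).1 x = some (s.1 x) := rfl

theorem eps_apply (A : Finset ℕ) (x : ℕ) : (eps A).1 x = if x ∈ A then none else some x := by
  by_cases h : x ∈ A
  · rw [if_pos h, Option.eq_none_iff_forall_ne_some]
    intro y hy
    exact (PEquiv.ofSet_eq_some_iff.1 hy).2 (by rwa [(PEquiv.ofSet_eq_some_iff.1 hy).1])
  · rw [if_neg h]
    exact PEquiv.ofSet_eq_some_self_iff.2 h

theorem star_toRInf (s : SInf) : star (SInf.toRInf s) = SInf.toRInf s⁻¹ := rfl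

theorem star_toRInf_mul_self (s : SInf) : star (SInf.toRInf s) * SInf.toRInf s = 1 := by
  rw [star_toRInf, ← map_mul, inv_mul_cancel, map_one]

/-- A transposition of fixed points of `r` commutes with `r`. -/
theorem commute_swap {r : RInf} {a b : ℕ} (ha : r.1 a = some a) (hb : r.1 b = some b) :
    Commute r (SInf.toRInf (SInf.swap a b)) := by
  refine RInf.ext fun x => ?_
  simp only [mul_apply, toRInf_apply, Option.bind_some]
  change r.1 (Equiv.swap a b x) = (r.1 x).bind fun y => some (Equiv.swap a b y)
  by_cases hxa : x = a
  · simp [hxa, ha, hb]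
  by_cases hxb : x = b
  · simp [hxb, ha, hb]
  rw [Equiv.swap_apply_of_ne_of_ne hxa hxb]
  cases hy : r.1 x with
  | none => rfl
  | some y =>
    have hya : y ≠ a := fun h => hxa (r.1.inj hy (h ▸ ha))
    have hyb : y ≠ b := fun h => hxb (r.1.inj hy (h ▸ hb))
    simp [Equiv.swap_apply_of_ne_of_ne hya hyb]

theorem eps_empty : eps ∅ = 1 :=
  RInf.ext fun x => by rw [eps_apply]; rfl

theorem eps_union (A B : Finset ℕ) : eps (A ∪ B) = eps A * eps B := by
  refine RInf.ext fun x => ?_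
  by_cases hB : x ∈ B <;> by_cases hA : x ∈ A <;> simp [mul_apply, eps_apply, hA, hB]

theorem star_eps (A : Finset ℕ) : star (eps A) = eps A :=
  Subtype.ext (PEquiv.ofSet_symm _)

theorem eps_mul_swap {A : Finset ℕ} {a b : ℕ} (ha : a ∈ A) (hb : b ∈ A) :
    eps A * SInf.toRInf (SInf.swap a b) = eps A := by
  refine RInf.ext fun x => ?_
  simp only [mul_apply, toRInf_apply, Option.bind_some]
  change (eps A).1 (Equiv.swap a b x) = _
  by_cases hxa : x = a
  · simp [hxa, eps_apply, ha, hb]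
  by_cases hxb : x = b
  · simp [hxb, eps_apply, ha, hb]
  rw [Equiv.swap_apply_of_ne_of_ne hxa hxb]

theorem toRInf_mul_eps_singleton (s : SInf) (a : ℕ) :
    SInf.toRInf s * eps {a} = eps {s.1 a} * SInf.toRInf s := by
  refine RInf.ext fun x => ?_
  by_cases hx : x = a <;> simp [mul_apply, eps_apply, toRInf_apply, hx]

end RInf

namespace RInf

variable {H : Type*} [NormedAddCommGroup H] [InnerProductSpace ℂ H] [CompleteSpace H]
  {φ : RInf → ℂ} {π : RInf →⋆* (H →L[ℂ] H)} {ξ : H}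

theorem apply_mem_vonNeumann (π : RInf →⋆* (H →L[ℂ] H)) (r : RInf) : π r ∈ vonNeumann π := by
  rw [← SetLike.mem_coe, coe_vonNeumann]
  exact Set.subset_centralizer_centralizer ⟨r, rfl⟩

theorem mem_commutant_vonNeumann_iff {x : H →L[ℂ] H} :
    x ∈ (vonNeumann π).commutant ↔ ∀ r, π r * x = x * π r := by
  rw [← SetLike.mem_coe, VonNeumannAlgebra.coe_commutant, coe_vonNeumann,
    Set.centralizer_centralizer_centralizer]
  simp [Set.mem_centralizer_iff]

theorem inner_apply_left (π : RInf →⋆* (H →L[ℂ] H)) (r : RInf) (v w : H) :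
    inner ℂ (π r v) w = inner ℂ v (π (star r) w) := by
  rw [map_star, ContinuousLinearMap.star_eq_adjoint, ContinuousLinearMap.adjoint_inner_right]

theorem map_mul_apply (π : RInf →⋆* (H →L[ℂ] H)) (r q : RInf) (v : H) :
    π (r * q) v = π r (π q v) := by
  rw [map_mul]; rfl

theorem norm_toRInf_apply (π : RInf →⋆* (H →L[ℂ] H)) (s : SInf) (v : H) :
    ‖π (SInf.toRInf s) v‖ = ‖v‖ := by
  have h : inner ℂ (π (SInf.toRInf s) v) (π (SInf.toRInf s) v) = inner ℂ v v := by
    rw [inner_apply_left, ← map_mul_apply, star_toRInf_mul_self, map_one]; rfl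
  simp only [inner_self_eq_norm_sq_to_K] at h
  have h' : ‖π (SInf.toRInf s) v‖ ^ 2 = ‖v‖ ^ 2 := by exact_mod_cast h
  exact (sq_eq_sq₀ (norm_nonneg _) (norm_nonneg _)).1 h'

theorem IsGNS.norm_eq_one (hgns : IsGNS φ π ξ) (h1 : φ 1 = 1) : ‖ξ‖ = 1 := by
  have h := hgns.apply_eq 1
  rw [h1, map_one, one_apply_eq_self, inner_self_eq_norm_sq_to_K] at h
  have h' : ‖ξ‖ ^ 2 = 1 := Complex.ofReal_injective (by simpa using h.symm)
  exact (pow_eq_one_iff_of_nonneg (norm_nonneg _) two_ne_zero).1 h'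

theorem IsGNS.inner_apply_apply (hgns : IsGNS φ π ξ) (r q : RInf) :
    inner ℂ (π r ξ) (π q ξ) = φ (star r * q) := by
  rw [inner_apply_left, ← map_mul_apply, hgns.apply_eq]

theorem IsGNS.denseRange (hgns : IsGNS φ π ξ) :
    DenseRange (Finsupp.linearCombination ℂ fun r => π r ξ) := by
  rw [DenseRange, ← LinearMap.coe_range, Finsupp.range_linearCombination,
    Submodule.dense_iff_topologicalClosure_eq_top]
  exact hgns.cyclic

theorem IsGNS.ext_of_apply_eq (hgns : IsGNS φ π ξ) {x y : H →L[ℂ] H}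
    (h : ∀ r, x (π r ξ) = y (π r ξ)) : x = y := by
  refine ContinuousLinearMap.ext_on ?_ (s := Set.range fun r => π r ξ) ?_
  · exact Submodule.dense_iff_topologicalClosure_eq_top.2 hgns.cyclic
  · rintro _ ⟨r, rfl⟩
    exact h r

/-- By centrality, `π s ξ` is the image of `ξ` under an isometry in the commutant. -/
theorem IsGNS.exists_commutant_isometry (hgns : IsGNS φ π ξ) (hcentral : IsSInfCentral φ)
    (s : SInf) : ∃ U ∈ (vonNeumann π).commutant,
      (∀ v, ‖U v‖ = ‖v‖) ∧ U ξ = π (SInf.toRInf s) ξ := by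
  let T := Finsupp.linearCombination ℂ fun r => π r ξ
  let T' := Finsupp.linearCombination ℂ fun r => π (r * SInf.toRInf s) ξ
  have hgram (r q : RInf) : inner ℂ (π (r * SInf.toRInf s) ξ) (π (q * SInf.toRInf s) ξ) =
      inner ℂ (π r ξ) (π q ξ) := by
    rw [hgns.inner_apply_apply, hgns.inner_apply_apply, star_mul, star_toRInf, mul_assoc,
      hcentral, mul_assoc, mul_assoc, ← map_mul, mul_inv_cancel, map_one, mul_one]
  have hnorm (f : RInf →₀ ℂ) : ‖T' f‖ = ‖T f‖ := by
    have h : inner ℂ (T' f) (T' f) = inner ℂ (T f) (T f) := by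
      simp only [T, T', Finsupp.linearCombination_apply, Finsupp.sum, sum_inner, inner_sum,
        inner_smul_left, inner_smul_right, hgram]
    rw [@norm_eq_sqrt_re_inner ℂ, @norm_eq_sqrt_re_inner ℂ, h]
  have hdense : DenseRange T := hgns.denseRange
  let U : H →L[ℂ] H := T'.extendOfNorm T
  have hUT (f : RInf →₀ ℂ) : U (T f) = T' f :=
    LinearMap.extendOfNorm_eq hdense ⟨1, fun f => by rw [hnorm, one_mul]⟩ f
  have hU (r : RInf) : U (π r ξ) = π (r * SInf.toRInf s) ξ := by
    simpa [T, T'] using hUT (Finsupp.single r 1)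
  refine ⟨U, mem_commutant_vonNeumann_iff.2 fun r => hgns.ext_of_apply_eq fun q => ?_,
    fun v => ?_, ?_⟩
  · simp only [mul_apply_eq_comp, hU, ← map_mul_apply, mul_assoc]
  · refine hdense.induction_on v
      (isClosed_eq (continuous_norm.comp U.continuous) continuous_norm) fun f => ?_
    rw [hUT, hnorm]
  · simpa using hU 1

theorem IsSInfCentral.swap_eq (hcentral : IsSInfCentral φ) {a b c d : ℕ} (hab : a ≠ b)
    (hcd : c ≠ d) : φ (SInf.toRInf (SInf.swap a b)) = φ (SInf.toRInf (SInf.swap c d)) := by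
  obtain ⟨s, hs⟩ := SInf.exists_conj_swap hab hcd
  rw [← hs, mul_assoc, map_mul, hcentral, ← map_mul, mul_assoc, inv_mul_cancel, mul_one]

/-- For a type I factor, the value of the state at a transposition has modulus one. -/
theorem IsGNS.norm_swap_eq_one (hgns : IsGNS φ π ξ) (h1 : φ 1 = 1)
    (hcentral : IsSInfCentral φ) (hfactor : (vonNeumann π).IsFactor)
    (htype : (vonNeumann π).IsTypeI) {a b : ℕ} (hab : a ≠ b) :
    ‖φ (SInf.toRInf (SInf.swap a b))‖ = 1 := by
  have hξ := hgns.norm_eq_one h1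
  let s (i : ℕ) : SInf := SInf.swap (2 * i) (2 * i + 1)
  let u (i : ℕ) : H →L[ℂ] H := π (SInf.toRInf (s i))
  have hu (i : ℕ) : ‖u i‖ ≤ 1 := ContinuousLinearMap.opNorm_le_bound _ zero_le_one fun v => by
    rw [norm_toRInf_apply, one_mul]
  have huM (i : ℕ) : u i ∈ vonNeumann π := apply_mem_vonNeumann π _
  have hcomm (r : RInf) : ∀ᶠ i in (hyperfilter ℕ : Filter ℕ), Commute (π r) (u i) := by
    refine Filter.Eventually.filter_mono Nat.hyperfilter_le_atTop ?_
    obtain ⟨N, hN⟩ := r.2.bddAbove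
    filter_upwards [eventually_gt_atTop N] with i hi
    have hfix (x : ℕ) (hx : N < x) : r.1 x = some x := by
      by_contra h
      exact absurd (hN h) (not_le.2 hx)
    exact (commute_swap (hfix _ (by omega)) (hfix _ (by omega))).map π
  obtain ⟨O, hO⟩ := (hyperfilter ℕ).exists_tendsto_inner u hu
  have hO_comm (x : H →L[ℂ] H)
      (hx : ∀ᶠ i in (hyperfilter ℕ : Filter ℕ), Commute x (u i)) : x * O = O * x := by
    ext w
    refine ext_inner_left ℂ fun v => ?_
    have h := hO (star x v) w
    simp only [ContinuousLinearMap.star_eq_adjoint, ContinuousLinearMap.adjoint_inner_left] at h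
    refine tendsto_nhds_unique h ((hO v (x w)).congr' ?_)
    filter_upwards [hx] with i hi
    exact congr(inner ℂ v ($(hi.eq.symm) w))
  have hOM : O ∈ vonNeumann π := VonNeumannAlgebra.mem_of_forall_commutant fun y hy =>
    hO_comm y (Eventually.of_forall fun i =>
      (VonNeumannAlgebra.mem_commutant_iff.1 hy (u i) (huM i)).symm)
  have hOM' : O ∈ (vonNeumann π).commutant :=
    mem_commutant_vonNeumann_iff.2 fun r => hO_comm _ (hcomm r)
  obtain ⟨l, rfl⟩ := hfactor O hOM hOM'
  have hlim (v w : H) : Tendsto (fun i => inner ℂ v (u i w)) (hyperfilter ℕ : Filter ℕ)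
      (𝓝 (l * inner ℂ v w)) := by
    rw [← inner_smul_right]
    exact hO v w
  have hφ : φ (SInf.toRInf (SInf.swap a b)) = l := by
    have h := hlim ξ ξ
    rw [inner_self_eq_one_of_norm_eq_one hξ, mul_one] at h
    refine tendsto_nhds_unique (tendsto_const_nhds.congr fun i => ?_) h
    rw [← hgns.apply_eq]
    exact hcentral.swap_eq hab (by omega)
  rw [hφ]
  obtain ⟨e, he, hproj, hab, hsupp⟩ := htype
  have he0 : e ≠ 0 := by
    rintro rfl
    have h01 : (0 : H →L[ℂ] H) = 1 := hsupp 0 (zero_mem _) (zero_mem _) hproj (mul_zero _)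
    have : ξ = 0 := congr($h01.symm ξ)
    simp [this] at hξ
  obtain ⟨r, hr⟩ : ∃ r, e (π r ξ) ≠ 0 := by
    by_contra! h
    exact he0 (hgns.ext_of_apply_eq h)
  choose U hUM hU hUξ using fun i => hgns.exists_commutant_isometry hcentral (s i)
  exact hfactor.norm_eq_one_of_tendsto he hproj hab huM hu hUM hU hUξ hlim
    (apply_mem_vonNeumann π r) hr

/-- For a type I factor, all transpositions fix the cyclic vector, or all of them negate it. -/
theorem IsGNS.swap_apply_eq (hgns : IsGNS φ π ξ) (h1 : φ 1 = 1) (hcentral : IsSInfCentral φ)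
    (hfactor : (vonNeumann π).IsFactor) (htype : (vonNeumann π).IsTypeI) :
    (∀ a b, a ≠ b → π (SInf.toRInf (SInf.swap a b)) ξ = ξ) ∨
      ∀ a b, a ≠ b → π (SInf.toRInf (SInf.swap a b)) ξ = -ξ := by
  have hξ := hgns.norm_eq_one h1
  let l := φ (SInf.toRInf (SInf.swap 0 1))
  have heig (a b : ℕ) (hab : a ≠ b) : π (SInf.toRInf (SInf.swap a b)) ξ = l • ξ := by
    have hl : inner ℂ ξ (π (SInf.toRInf (SInf.swap a b)) ξ) = l := by
      rw [← hgns.apply_eq]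
      exact hcentral.swap_eq hab zero_ne_one
    have hn : ‖l‖ = 1 := hgns.norm_swap_eq_one h1 hcentral hfactor htype zero_ne_one
    have h0 := (norm_inner_eq_norm_tfae ℂ ξ (π (SInf.toRInf (SInf.swap a b)) ξ)).out 0 1
    have h2 := (h0.1 (by rw [hl, hn, norm_toRInf_apply, hξ, one_mul])).resolve_left
      (by rintro rfl; simp at hξ)
    rw [h2, hl, inner_self_eq_norm_sq_to_K, hξ]
    simp
  have hsq : l * l = 1 := by
    have h := congr(π (SInf.toRInf $(SInf.swap_mul_self 0 1)) ξ)
    rw [map_mul, map_mul_apply, heig 0 1 zero_ne_one, map_smul, heig 0 1 zero_ne_one, map_one,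
      map_one, one_apply_eq_self, smul_smul] at h
    have h' : (l * l - 1) • ξ = 0 := by rw [sub_smul, h, one_smul, sub_self]
    exact sub_eq_zero.1 ((smul_eq_zero.1 h').resolve_right (by rintro rfl; simp at hξ))
  rcases mul_self_eq_one_iff.1 hsq with h | h
  · left; simpa [h] using heig
  · right; simpa [h] using heig

theorem toRInf_apply_eq_pow {c : ℂ} (h : ∀ a b, a ≠ b → π (SInf.toRInf (SInf.swap a b)) ξ = c • ξ)
    {l : List (Equiv.Perm ℕ)} (hl : ∀ g ∈ l, g.IsSwap) {s : SInf} (hs : l.prod = s.1) :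
    π (SInf.toRInf s) ξ = c ^ l.length • ξ := by
  induction l generalizing s with
  | nil =>
    obtain rfl : s = 1 := Subtype.ext hs.symm
    simp
  | cons g l ih =>
    obtain ⟨a, b, hab, rfl⟩ := hl g List.mem_cons_self
    have hs' : s = SInf.swap a b * ((SInf.swap a b)⁻¹ * s) := by group
    have hl' : l.prod = ((SInf.swap a b)⁻¹ * s).1 := by
      rw [Subgroup.coe_mul, ← hs, List.prod_cons]
      exact (inv_mul_cancel_left (Equiv.swap a b) _).symm
    rw [hs', map_mul, map_mul_apply, ih (fun g hg => hl g (List.mem_cons_of_mem _ hg)) hl',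
      map_smul, h a b hab, smul_smul, List.length_cons, pow_succ]

theorem IsGNS.isTwoSidedInvariant (hgns : IsGNS φ π ξ)
    (h : ∀ a b, a ≠ b → π (SInf.toRInf (SInf.swap a b)) ξ = ξ) : IsTwoSidedInvariant φ := by
  have hfix (s : SInf) : π (SInf.toRInf s) ξ = ξ := by
    obtain ⟨l, hl, hs⟩ := SInf.exists_swap_list s
    simpa using toRInf_apply_eq_pow (c := 1) (by simpa using h) hl hs
  intro s t r
  rw [hgns.apply_eq, hgns.apply_eq, map_mul_apply, hfix, map_mul_apply, ← star_star (SInf.toRInf s),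
    ← inner_apply_left, star_toRInf, hfix]

theorem toRInf_apply_eq_sign (h : ∀ a b, a ≠ b → π (SInf.toRInf (SInf.swap a b)) ξ = -ξ)
    (s : SInf) : π (SInf.toRInf s) ξ = (SInf.sign s : ℂ) • ξ := by
  have hpow {l : List (Equiv.Perm ℕ)} (hl : ∀ g ∈ l, g.IsSwap) (hs : l.prod = s.1) :=
    toRInf_apply_eq_pow (c := -1) (by simpa using h) hl hs
  rw [SInf.sign]
  split_ifs with hex
  · obtain ⟨l, hl, hs, heven⟩ := hex
    rw [hpow hl hs, heven.neg_one_pow]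
    simp
  · obtain ⟨l, hl, hs⟩ := SInf.exists_swap_list s
    have hodd : Odd l.length := Nat.not_even_iff_odd.1 fun he => hex ⟨l, hl, hs, he⟩
    rw [hpow hl hs, hodd.neg_one_pow]
    simp

theorem eps_apply_eq_zero
    (h : ∀ a b, a ≠ b → π (SInf.toRInf (SInf.swap a b)) ξ = -ξ) {A : Finset ℕ}
    (hA : A.Nonempty) : π (eps A) ξ = 0 := by
  have hpair {a b : ℕ} (hab : a ≠ b) : π (eps ({a} ∪ {b})) ξ = 0 := by
    have h2 := congr(π $(eps_mul_swap (A := {a} ∪ {b}) (a := a) (b := b) (by simp) (by simp)) ξ)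
    rw [map_mul_apply, h a b hab, map_neg] at h2
    have h3 : (2 : ℂ) • π (eps ({a} ∪ {b})) ξ = 0 := by
      rw [two_smul]
      nth_rewrite 1 [← h2]
      exact neg_add_cancel _
    exact (smul_eq_zero.1 h3).resolve_left two_ne_zero
  have hinner (a : ℕ) : inner ℂ (π (eps {a}) ξ) ξ = inner ℂ (π (eps {a}) ξ) (π (eps {a}) ξ) := by
    rw [inner_apply_left, inner_apply_left, ← map_mul_apply, star_eps, ← eps_union,
      Finset.union_self]
  have hconst (a : ℕ) : ‖π (eps {a}) ξ‖ = ‖π (eps {0}) ξ‖ := by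
    have hs := toRInf_mul_eps_singleton (SInf.swap 0 a) 0
    have ha : (SInf.swap 0 a).1 0 = a := Equiv.swap_apply_left 0 a
    rw [ha] at hs
    have hs' := congr(‖π $hs ξ‖)
    rw [map_mul_apply, norm_toRInf_apply, map_mul_apply] at hs'
    by_cases h0 : (0 : ℕ) = a
    · rw [h0]
    · rw [hs', h 0 a h0, map_neg, norm_neg]
  have hzero : ‖π (eps {0}) ξ‖ = 0 := by
    have hb (n : ℕ) : n * ‖π (eps {0}) ξ‖ ^ 2 ≤ ‖ξ‖ ^ 2 := by
      have := sum_norm_sq_le_of_pairwise_orthogonal (w := fun a => π (eps {a}) ξ) (fun a b hab => by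
        change inner ℂ _ _ = _
        rw [inner_apply_left, ← map_mul_apply, star_eps, ← eps_union, hpair hab, inner_zero_right])
        hinner (Finset.range n)
      simpa [hconst] using this
    by_contra h0
    obtain ⟨n, hn⟩ := exists_nat_gt (‖ξ‖ ^ 2 / ‖π (eps {0}) ξ‖ ^ 2)
    rw [div_lt_iff₀ (by positivity)] at hn
    exact absurd (hb n) (not_le.2 hn)
  obtain ⟨a, ha⟩ := hA
  rw [← Finset.union_eq_left.2 (Finset.singleton_subset_iff.2 ha), eps_union, map_mul_apply,
    norm_eq_zero.1 ((hconst a).trans hzero), map_zero]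

end RInf

theorem mainTheorem7 {H : Type*} [NormedAddCommGroup H] [InnerProductSpace ℂ H] [CompleteSpace H]
    (φ : RInf → ℂ) (hφ : RInf.IsState φ) (hcentral : RInf.IsSInfCentral φ)
    (π : RInf →⋆* (H →L[ℂ] H)) (ξ : H) (hgns : RInf.IsGNS φ π ξ)
    (hfactor : (RInf.vonNeumann π).IsFactor) (htype : (RInf.vonNeumann π).IsTypeI) :
    RInf.IsTwoSidedInvariant φ ∨
      ∀ (s : SInf) (A : Finset ℕ),
        φ (SInf.toRInf s * RInf.eps A) = if A = ∅ then (SInf.sign s : ℂ) else 0 := by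
  rcases hgns.swap_apply_eq hφ.map_one hcentral hfactor htype with h | h
  · exact .inl (hgns.isTwoSidedInvariant h)
  · right
    intro s A
    rw [hgns.apply_eq, RInf.map_mul_apply]
    split_ifs with hA
    · rw [hA, RInf.eps_empty, map_one, one_apply_eq_self, RInf.toRInf_apply_eq_sign h,
        inner_smul_right, inner_self_eq_norm_sq_to_K, hgns.norm_eq_one hφ.map_one]
      simp
    · rw [RInf.eps_apply_eq_zero h (Finset.nonempty_iff_ne_empty.2 hA), map_zero,
        inner_zero_right]
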